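/- Let $M_1,M_2$ be models with the same vocabulary. A partial isomorphism from $M_1$ into $M_2$ is a partial function $f$ from $M_1$ to $M_2$ that preserves atomic formulas in both directions (in particular $f$ is injective; its domain need not be closed under the functions of $M_1$). For an ordinal $\alpha$ and a cardinal $\mu$, the Ehrenfeucht--Fraïssé game $\Game^\alpha_\mu(M_1,M_2)$ between the players AIS and ISO lasts $\alpha$ moves and builds an increasing continuous sequence $\langle f_\beta\rangle$ of partial isomorphisms from $M_1$ into $M_2$: $f_0=\emptyset$; in the $(\beta+1)$-th move ($\beta<\alpha$) AIS chooses $A_{\beta,1}\subseteq M_1$, $A_{\beta,2}\subseteq M_2$ with $|A_{\beta,1}|+|A_{\beta,2}|<1+\mu$, and then ISO chooses a partial isomorphism $f_{\beta+1}\supseteq f_\beta$ with $A_{\beta,1}\subseteq\mathrm{Dom}(f_{\beta+1})$ and $A_{\beta,2}\subseteq\mathrm{Rang}(f_{\beta+1})$; at limit $\beta$, $f_\beta=\bigcup_{\gamma<\beta}f_\gamma$. ISO loses if at some point there is no legal move, and wins otherwise. $M_1,M_2$ are EF$_{\alpha,\mu}$-equivalent if ISO has a winning strategy in $\Game^\alpha_\mu(M_1,M_2)$,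 and EF$_\alpha$-equivalent if they are EF$_{\alpha,1}$-equivalent. For $c\in M$, $(M,c)$ is the expansion of $M$ by an individual constant interpreted as $c$. Theorem. Let $\lambda$ be an infinite cardinal with $\lambda=\mathrm{cf}(\lambda)=\lambda^{\aleph_0}$. Then there is a model $M$ of cardinality $\lambda$ such that: (a) $M$ has no automorphism other than the identity. (b) (Part 1) For every ordinal $\alpha<\lambda$ there are $c_1\neq c_2$ in $M$ such that $(M,c_1)$ and $(M,c_2)$ are not isomorphic, but are EF$_\alpha$-equivalent and even EF$_{\alpha,\lambda}$-equivalent. (c) (Part 2) There are $c_1\neq c_2$ in $M$ such that $(M,c_1)$ and $(M,c_2)$ are not isomorphic, but are EF$_{\alpha,\lambda}$-equivalent for every ordinal $\alpha<\lambda$ simultaneously. -/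

import Mathlib

open Cardinal FirstOrder

universe u v w

namespace EFGame

section Game

variable (L : FirstOrder.Language.{v, w}) {M N : Type u} [L.Structure M] [L.Structure N]

/-- A partial isomorphism from `M` into `N`, given by its graph `f`: corresponding tuples satisfy
the same atomic formulas. Equality is atomic, so `f` is the graph of a partial injection; the domain
need not be closed under the functions of `M`. -/
def IsPartialIso (f : Set (M × N)) : Prop :=
  ∀ (n : ℕ) (φ : L.Formula (Fin n)), φ.IsAtomic →
    ∀ x : Fin n → M × N, (∀ i, x i ∈ f) →
      (φ.Realize (fun i => (x i).1) ↔ φ.Realize (fun i => (x i).2))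

variable (M N) in
/-- A move of the player AIS: sets `A₁ ⊆ M` and `A₂ ⊆ N` with `|A₁| + |A₂| < 1 + μ`. -/
def Challenge (μ : Cardinal.{u}) : Type u :=
  {A : Set M × Set N // #A.1 + #A.2 < 1 + μ}

variable (M N) in
/-- A strategy of the player ISO: in the `(β + 1)`-th move it answers the moves of AIS with
indices `≤ β` by (the graph of) `f_{β + 1}`. The earlier moves of ISO need not be recorded, since
they are determined by the strategy and the earlier moves of AIS. -/
def Strategy (μ : Cardinal.{u}) : Type (u + 1) :=
  (β : Ordinal.{u}) → (Set.Iic β → Challenge M N μ) → Set (M × N)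

/-- `f` lists the positions `f_β` (`β ≤ α`) of the play of length `α` starting from `f₀` in which
AIS plays `A` and ISO follows `σ`; at limits ISO takes unions. Only the values of `A` below `α` and
of `f` up to `α` matter. -/
structure IsPlay {μ : Cardinal.{u}} (σ : Strategy M N μ) (f₀ : Set (M × N)) (α : Ordinal.{u})
    (A : Ordinal.{u} → Challenge M N μ) (f : Ordinal.{u} → Set (M × N)) : Prop where
  zero : f 0 = f₀
  succ : ∀ β < α, f (β + 1) = σ β (fun γ => A γ)
  limit : ∀ β ≤ α, Order.IsSuccLimit β → f β = ⋃ γ < β, f γ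

/-- ISO never makes an illegal move during the `α` moves of the play `(A, f)`: all positions are
partial isomorphisms, they increase, and every challenge is met. -/
structure IsLegal {μ : Cardinal.{u}} (α : Ordinal.{u})
    (A : Ordinal.{u} → Challenge M N μ) (f : Ordinal.{u} → Set (M × N)) : Prop where
  partialIso : ∀ β ≤ α, IsPartialIso L (f β)
  extend : ∀ β < α, f β ⊆ f (β + 1)
  dom : ∀ β < α, (A β).1.1 ⊆ Prod.fst '' f (β + 1)
  rang : ∀ β < α, (A β).1.2 ⊆ Prod.snd '' f (β + 1)

/-- `σ` is a winning strategy of ISO in the game of length `α` that starts from `f₀`. -/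
def Strategy.IsWinning {μ : Cardinal.{u}} (σ : Strategy M N μ) (f₀ : Set (M × N))
    (α : Ordinal.{u}) : Prop :=
  ∀ (A : Ordinal.{u} → Challenge M N μ) (f : Ordinal.{u} → Set (M × N)),
    IsPlay σ f₀ α A f → IsLegal L α A f

variable (M N) in
/-- `M` and `N` are EF-equivalent for `α` and `μ`: ISO has a winning strategy in the game of length `α`
with challenges of size `< 1 + μ`, starting from the empty map. -/
def EFEquiv (α : Ordinal.{u}) (μ : Cardinal.{u}) : Prop :=
  ∃ σ : Strategy M N μ, σ.IsWinning L ∅ α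

end Game

/-- The underlying set of the expansion `(M, c)` of `M` by one individual constant `c`. -/
def Pointed (M : Type u) (_c : M) : Type u := M

/-- The expansion `(M, c)` as a structure for `L` with one new constant symbol,
interpreted by `c`. -/
noncomputable instance Pointed.structure (L : FirstOrder.Language.{v, w}) (M : Type u) [inst : L.Structure M]
    (c : M) : (L[[PUnit.{1}]]).Structure (Pointed M c) :=
  letI : L.Structure (Pointed M c) := inst
  letI : (FirstOrder.Language.constantsOn PUnit.{1}).Structure (Pointed M c) :=
    FirstOrder.Language.constantsOn.structure (fun _ => c)
  inferInstance

end EFGame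

/-!
Fix a regular `λ` with `λ ^ ℵ₀ = λ`, so that `λ` is uncountable, and call the elements of `λ`
moments. A *clock* on a set `s` of moments (`Clock`) assigns to every moment a stage below a fixed
bound and a deadline after the moment, which depends only on the stage. There is no clock on all
moments (`isEmpty_clock_univ`): it would use fewer than `λ` stages, hence fewer than `λ` deadlines,
and by regularity some moment would be past all of them.

Let `G s` be the group of finite sets of clocks on `s`, with symmetric difference. The model is the
disjoint union of the groups `G s` for countable `s`, with relations that recognize the groups, the
translations, and the projections `G t → G s` for `s ⊆ t`. Therefore an automorphism amounts to an
element of the inverse limit of the groups. Since the countable sets are countably directed, the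
sizes of the supports along a thread are bounded, and a nonzero thread would yield a clock on all
moments (`eq_zero_of_forall_proj_eq`). So the model is rigid, and as its two elements over the empty
set are distinct, the expansions by them are not isomorphic.

Yet ISO wins each game of length `α < λ` between these expansions (`efEquiv_clockModel`): ISO builds
a clock whose stages are the moves of the game, the deadline of a stage being a bound for the
countable sets that occur in the challenge of AIS at that move, and answers with the translation by
the restrictions of this clock. What the clock does before the deadlines reached so far does not
depend on later moves, and a translation by restrictions of one clock preserves all relations.
-/

namespace EFGame

/-! ### Structures with binary relations -/

/-- The language with the elements of `R` as binary relation symbols and no other symbols. -/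
def binaryLanguage (R : Type u) : FirstOrder.Language.{u, u} where
  Functions _ := PEmpty
  Relations n := {_r : R // n = 2}

/-- The structure on `M` in which the symbol `r` is interpreted as `rel r`. -/
abbrev binaryStructure {R M : Type u} (rel : R → M → M → Prop) : (binaryLanguage R).Structure M where
  funMap f := PEmpty.elim f
  RelMap {n} r x := rel r.1 (x ⟨0, by have := r.2; omega⟩) (x ⟨1, by have := r.2; omega⟩)

/-- Besides the variables, the only term is the new constant, so the atomic formulas are preserved
once `Φ` respects equality and the relations and relates the two constants. -/
theorem isPartialIso_of_subset {R M : Type u} [inst : (binaryLanguage R).Structure M]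
    {rel : R → M → M → Prop} (hM : inst = binaryStructure rel) {c₁ c₂ : M} {Φ : Set (M × M)}
    (hc : (c₁, c₂) ∈ Φ) (hinj : ∀ p ∈ Φ, ∀ q ∈ Φ, (p.1 = q.1 ↔ p.2 = q.2))
    (hrel : ∀ r, ∀ p ∈ Φ, ∀ q ∈ Φ, (rel r p.1 q.1 ↔ rel r p.2 q.2)) {f : Set (M × M)}
    (hf : f ⊆ Φ) :
    IsPartialIso ((binaryLanguage R)[[PUnit.{1}]]) (M := Pointed M c₁) (N := Pointed M c₂) f := by
  intro n φ hφ x hx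
  have key : ∀ t : ((binaryLanguage R)[[PUnit.{1}]]).Term (Fin n ⊕ Fin 0),
      ((t.realize (M := Pointed M c₁) (Sum.elim (fun i => (x i).1) default),
        t.realize (M := Pointed M c₂) (Sum.elim (fun i => (x i).2) default)) : M × M) ∈ Φ := by
    intro t
    rcases t with (i | i) | @⟨l, g, ts⟩
    · exact hf (hx i)
    · exact i.elim0
    · rcases g with g | g
      · exact PEmpty.elim g
      · cases l with
        | zero => exact hc
        | succ l => exact isEmptyElim g
  cases hφ with
  | equal t₁ t₂ =>
    rw [FirstOrder.Language.Formula.Realize, FirstOrder.Language.Formula.Realize,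
      FirstOrder.Language.BoundedFormula.realize_bdEqual,
      FirstOrder.Language.BoundedFormula.realize_bdEqual]
    exact hinj _ (key t₁) _ (key t₂)
  | @rel l r ts =>
    rcases r with r | r
    · subst hM
      obtain ⟨r, rfl⟩ := r
      exact hrel r _ (key (ts 0)) _ (key (ts 1))
    · exact isEmptyElim r

/-- If `M` is rigid, then expansions of `M` by distinct constants are not isomorphic. -/
theorem isEmpty_pointed_equiv {L : FirstOrder.Language.{v, w}} {M : Type u} [L.Structure M]
    (hM : ∀ f : M ≃[L] M, f = FirstOrder.Language.Equiv.refl L M) {c₁ c₂ : M} (hc : c₁ ≠ c₂) :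
    IsEmpty (Pointed M c₁ ≃[L[[PUnit.{1}]]] Pointed M c₂) := by
  refine ⟨fun e => hc ?_⟩
  let e' : M ≃[L] M :=
    { toEquiv := e.toEquiv
      map_fun' := fun {n} f x => e.map_fun' (Sum.inl f : (L[[PUnit.{1}]]).Functions n) x
      map_rel' := fun {n} r x => e.map_rel' (Sum.inl r : (L[[PUnit.{1}]]).Relations n) x }
  have h1 : e' c₁ = c₂ :=
    e.map_fun' (Sum.inr PUnit.unit : (L[[PUnit.{1}]]).Functions 0) (default : Fin 0 → Pointed M c₁)
  rw [hM e'] at h1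
  exact h1

/-! ### Clocks -/

/-- A clock on a set `s` of moments gives to each `x ∈ s` a triple `(a, i, d)`: a bound `a`, which
does not depend on `x`, a stage `i < a`, and a deadline `d > x`, which depends on the stage only. -/
@[ext]
structure Clock {K : Type u} [LinearOrder K] (s : Set K) : Type u where
  /-- The triple of bound, stage and deadline at a moment. -/
  val : s → K × K × K
  property : ∀ x y : s, (val x).1 = (val y).1 ∧ (val x).2.1 < (val x).1 ∧
    (x : K) < (val x).2.2 ∧ ((val x).2.1 = (val y).2.1 → (val x).2.2 = (val y).2.2)

section Clocks

variable {K : Type u} [LinearOrder K]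

/-- The restriction of a clock to a smaller set of moments. -/
def Clock.restrict {s t : Set K} (h : s ⊆ t) (f : Clock t) : Clock s :=
  ⟨fun x => f.val (Set.inclusion h x), fun _ _ => f.property _ _⟩

theorem Clock.restrict_restrict {s t r : Set K} (h : s ⊆ t) (h' : t ⊆ r) (f : Clock r) :
    Clock.restrict h (Clock.restrict h' f) = Clock.restrict (h.trans h') f := rfl

instance : Inhabited (Clock (∅ : Set K)) :=
  ⟨⟨fun x => x.2.elim, fun x => x.2.elim⟩⟩

/-- The group of finite sets of clocks on `s`, with symmetric difference as addition. -/
abbrev ClockGroup (s : Set K) : Type u := Clock s →₀ ZMod 2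

/-- The homomorphism between groups of finite sets of clocks that restriction induces. -/
noncomputable def proj {s t : Set K} (h : s ⊆ t) : ClockGroup t →+ ClockGroup s :=
  Finsupp.mapDomain.addMonoidHom (Clock.restrict h)

theorem proj_single {s t : Set K} (h : s ⊆ t) (f : Clock t) :
    proj h (Finsupp.single f 1) = Finsupp.single (f.restrict h) 1 :=
  Finsupp.mapDomain_single

/-- The inverse limit of the groups of finite sets of clocks over the countable sets is trivial
when there is no global clock. The sizes of the supports of a nonzero thread are bounded, because
countably many countable sets have a countable union; where the size is maximal, restriction is
bijective between supports, so that a point of the support propagates to a global clock. -/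
theorem eq_zero_of_forall_proj_eq (hK : IsEmpty (Clock (Set.univ : Set K)))
    (c : ∀ s : {s : Set K // s.Countable}, ClockGroup s.1)
    (hc : ∀ s t (h : s.1 ⊆ t.1), proj h (c t) = c s) (s : {s : Set K // s.Countable}) :
    c s = 0 := by
  classical
  by_contra hs
  have himg : ∀ s t (h : s.1 ⊆ t.1), (c s).support ⊆ (c t).support.image (Clock.restrict h) := by
    intro s t h
    rw [← hc s t h]
    exact Finsupp.mapDomain_support
  have hmono : ∀ s t : {s : Set K // s.Countable}, s.1 ⊆ t.1 →
      (c s).support.card ≤ (c t).support.card := fun s t h =>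
    (Finset.card_le_card (himg s t h)).trans Finset.card_image_le
  have hbdd : ∃ n, ∀ t, (c t).support.card ≤ n := by
    by_contra! hcon
    choose t ht using hcon
    let T : {s : Set K // s.Countable} :=
      ⟨⋃ n, (t n).1, Set.countable_iUnion fun n => (t n).2⟩
    have := (ht (c T).support.card).trans_le
      (hmono _ T (Set.subset_iUnion (fun n => (t n).1) _))
    exact lt_irrefl _ this
  -- A set containing `s` on which the support has maximal size.
  obtain ⟨m, hsm, hm⟩ : ∃ m : {s : Set K // s.Countable}, s.1 ⊆ m.1 ∧
      ∀ t : {s : Set K // s.Countable}, m.1 ⊆ t.1 → (c t).support.card ≤ (c m).support.card := by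
    obtain ⟨n, hn⟩ := hbdd
    have hfin : (Set.range fun t => (c t).support.card).Finite :=
      (Set.finite_Iic n).subset (by rintro _ ⟨t, rfl⟩; exact hn t)
    obtain ⟨_, ⟨m, rfl⟩, hm⟩ := hfin.exists_maximal ⟨_, ⟨s, rfl⟩⟩
    have hm' : ∀ t, (c t).support.card ≤ (c m).support.card := fun t => by
      by_contra! hlt
      exact (hm ⟨t, rfl⟩ hlt.le).not_gt hlt
    refine ⟨⟨s.1 ∪ m.1, s.2.union m.2⟩, Set.subset_union_left, fun t _ => ?_⟩
    exact (hm' t).trans (hmono m ⟨s.1 ∪ m.1, s.2.union m.2⟩ Set.subset_union_right)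
  have himg_eq : ∀ t (h : m.1 ⊆ t.1), ∀ r (h' : t.1 ⊆ r.1),
      (c t).support = (c r).support.image (Clock.restrict h') := by
    intro t h r h'
    refine Finset.eq_of_subset_of_card_le (himg t r h') ?_
    exact Finset.card_image_le.trans ((hm r (h.trans h')).trans (hmono m t h))
  have hinj : ∀ t (h : m.1 ⊆ t.1), Set.InjOn (Clock.restrict h) (c t).support := by
    intro t h
    rw [← Finset.card_image_iff, ← himg_eq m subset_rfl t h]
    exact le_antisymm (hmono m t h) (hm t h)
  have hm0 : (c m).support.Nonempty := by
    rw [Finsupp.support_nonempty_iff]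
    intro h0
    exact hs (by rw [← hc s m hsm, h0, map_zero])
  obtain ⟨f, hf⟩ := hm0
  have hex : ∀ t (h : m.1 ⊆ t.1), ∃ g ∈ (c t).support, Clock.restrict h g = f := by
    intro t h
    rw [himg_eq m subset_rfl t h] at hf
    simpa using hf
  choose g hg hgf using hex
  have hres : ∀ t (h : m.1 ⊆ t.1) r (h' : t.1 ⊆ r.1),
      Clock.restrict h' (g r (h.trans h')) = g t h := by
    intro t h r h'
    refine hinj t h ?_ (hg t h) ?_
    · rw [himg_eq t h r h']
      exact Finset.mem_coe.2 (Finset.mem_image_of_mem _ (hg r _))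
    · rw [hgf, Clock.restrict_restrict, hgf]
  let e : K → {s : Set K // s.Countable} := fun x => ⟨insert x m.1, m.2.insert x⟩
  have he : ∀ x, m.1 ⊆ (e x).1 := fun x => Set.subset_insert _ _
  refine hK.elim ⟨fun x => (g (e x) (he x)).1 ⟨x, Set.mem_insert _ _⟩, fun x y => ?_⟩
  let r : {s : Set K // s.Countable} := ⟨insert x.1 (insert y.1 m.1), (m.2.insert _).insert _⟩
  have hx : (e x).1 ⊆ r.1 := Set.insert_subset_insert (Set.subset_insert _ _)
  have hy : (e y).1 ⊆ r.1 := Set.subset_insert _ _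
  simp only [← hres _ (he x) r hx, ← hres _ (he y) r hy]
  exact (g r _).property _ _

theorem exists_forall_lt_of_mk_lt {lam : Cardinal.{u}} (hreg : lam.IsRegular)
    {S : Set lam.ord.ToType} (hS : #S < lam) : ∃ b, ∀ x ∈ S, x < b := by
  by_contra! h
  have h1 : IsCofinal S := fun b => h b
  have h2 := Order.cof_le h1
  rw [Ordinal.cof_toType, hreg.cof_ord] at h2
  exact h2.not_gt hS

/-- The bound of a global clock leaves fewer than `lam` stages, so some moment would be past all
deadlines. -/
theorem isEmpty_clock_univ {lam : Cardinal.{u}} (hreg : lam.IsRegular) :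
    IsEmpty (Clock (Set.univ : Set lam.ord.ToType)) := by
  refine ⟨fun f => ?_⟩
  have hne : lam ≠ 0 := hreg.pos.ne'
  let F : lam.ord.ToType → lam.ord.ToType × lam.ord.ToType × lam.ord.ToType :=
    fun x => f.1 ⟨x, trivial⟩
  have hF : ∀ x y, (F x).1 = (F y).1 ∧ (F x).2.1 < (F x).1 ∧ x < (F x).2.2 ∧
    ((F x).2.1 = (F y).2.1 → (F x).2.2 = (F y).2.2) := fun x y => f.2 ⟨x, trivial⟩ ⟨y, trivial⟩
  have : Nonempty lam.ord.ToType := by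
    rw [← Cardinal.mk_ne_zero_iff, Cardinal.mk_ord_toType]; exact hne
  have x₀ := Classical.arbitrary lam.ord.ToType
  have hcard : #(Set.range fun x => (F x).2.2) < lam := by
    -- The deadline is a function of the stage.
    have h1 : (Set.range fun x => (F x).2.2) ⊆
        (fun i => (F (Function.invFun (fun x => (F x).2.1) i)).2.2) '' Set.Iio (F x₀).1 := by
      rintro _ ⟨x, rfl⟩
      refine ⟨(F x).2.1, ?_, (hF _ _).2.2.2 (Function.invFun_eq (f := fun x => (F x).2.1) ⟨x, rfl⟩)⟩
      rw [Set.mem_Iio, (hF x₀ x).1]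
      exact (hF x x).2.1
    refine ((Cardinal.mk_le_mk_of_subset h1).trans Cardinal.mk_image_le).trans_lt ?_
    simpa using Cardinal.mk_Iio_lt (F x₀).1
  obtain ⟨b, hb⟩ := exists_forall_lt_of_mk_lt hreg hcard
  exact lt_asymm (hb _ ⟨b, rfl⟩) (hF b b).2.2.1

end Clocks

/-! ### The rigid model -/

section Model

variable (K : Type u) [LinearOrder K]

/-- The universe of the rigid model: the disjoint union, over the countable sets `s`, of the groups
of finite sets of clocks on `s`. -/
def ClockModel : Type u :=
  Σ s : {s : Set K // s.Countable}, ClockGroup s.1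

/-- A relation symbol of the rigid model: a pair of countable sets `small ⊆ big` and an element
`shift` of the group at `small`. -/
structure ClockSymbol where
  /-- The set of moments that indexes the first argument. -/
  big : {s : Set K // s.Countable}
  /-- The set of moments that indexes the second argument. -/
  small : {s : Set K // s.Countable}
  subset : small.1 ⊆ big.1
  /-- The difference between the second argument and the projection of the first one. -/
  shift : ClockGroup small.1

variable {K}

/-- The interpretation of a relation symbol: `x` lies in the group at `big`, `y` in the group at
`small`, and `y` is the projection of `x` translated by `shift`. -/
def ClockModel.Rel (r : ClockSymbol K) (x y : ClockModel K) : Prop :=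
  ∃ a b, x = ⟨r.big, a⟩ ∧ y = ⟨r.small, b⟩ ∧ b = proj r.subset a + r.shift

noncomputable instance : (binaryLanguage (ClockSymbol K)).Structure (ClockModel K) :=
  binaryStructure ClockModel.Rel

theorem ClockModel.rel_mk_iff (r : ClockSymbol K) (a : ClockGroup r.big.1)
    (b : ClockGroup r.small.1) :
    ClockModel.Rel r ⟨r.big, a⟩ ⟨r.small, b⟩ ↔ b = proj r.subset a + r.shift := by
  constructor
  · rintro ⟨a', b', ha, hb, h⟩
    cases ha
    cases hb
    exact h
  · exact fun h => ⟨a, b, rfl, rfl, h⟩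

theorem ClockModel.rel_equiv
    (φ : ClockModel K ≃[binaryLanguage (ClockSymbol K)] ClockModel K) {r : ClockSymbol K}
    {x y : ClockModel K} (h : ClockModel.Rel r x y) : ClockModel.Rel r (φ x) (φ y) :=
  (φ.map_rel' (⟨r, rfl⟩ : (binaryLanguage (ClockSymbol K)).Relations 2) ![x, y]).2 h

/-- An automorphism translates each group by an element, and these elements form a thread of the
inverse system. -/
theorem ClockModel.equiv_eq_refl (hK : IsEmpty (Clock (Set.univ : Set K)))
    (φ : ClockModel K ≃[binaryLanguage (ClockSymbol K)] ClockModel K) :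
    φ = FirstOrder.Language.Equiv.refl _ _ := by
  have h0 : ∀ s, ∃ c : ClockGroup s.1, φ ⟨s, 0⟩ = ⟨s, c⟩ := by
    intro s
    obtain ⟨a, b, ha, -, -⟩ := ClockModel.rel_equiv φ
      ((ClockModel.rel_mk_iff ⟨s, s, subset_rfl, 0⟩ 0 0).2 (by simp))
    exact ⟨a, ha⟩
  choose c hc using h0
  have h1 : ∀ s t (h : s.1 ⊆ t.1) (g : ClockGroup s.1), φ ⟨s, g⟩ = ⟨s, proj h (c t) + g⟩ := by
    intro s t h g
    obtain ⟨a, b, ha, hb, hab⟩ := ClockModel.rel_equiv φ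
      ((ClockModel.rel_mk_iff ⟨t, s, h, g⟩ 0 g).2 (by simp))
    rw [hc] at ha
    cases ha
    rw [hb, hab]
  have h2 : ∀ s, c s = 0 := by
    refine eq_zero_of_forall_proj_eq hK c fun s t h => ?_
    have := (h1 s t h 0).symm.trans (hc s)
    rw [add_zero] at this
    exact eq_of_heq (Sigma.mk.inj this).2
  ext ⟨s, g⟩
  rw [h1 s s subset_rfl g, h2, map_zero, zero_add]
  rfl

theorem mk_clockModel {lam : Cardinal.{u}} (hreg : lam.IsRegular) (hpow : lam ^ ℵ₀ = lam) :
    #(ClockModel lam.ord.ToType) = lam := by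
  have hlam : ℵ₀ ≤ lam := hreg.aleph0_le
  have hK : #lam.ord.ToType = lam := Cardinal.mk_ord_toType lam
  have : Infinite lam.ord.ToType := by rw [Cardinal.infinite_iff, hK]; exact hlam
  apply le_antisymm
  · have hsets : #{s : Set lam.ord.ToType // s.Countable} ≤ lam := by
      have := Cardinal.mk_bounded_set_le_of_infinite lam.ord.ToType ℵ₀
      rw [hK, hpow] at this
      simpa only [Cardinal.le_aleph0_iff_set_countable] using this
    have hclock : ∀ s : {s : Set lam.ord.ToType // s.Countable}, #(Clock s.1) ≤ lam := by
      intro s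
      have hinj : Function.Injective (Clock.val (s := s.1)) := fun _ _ => Clock.ext
      refine (Cardinal.mk_le_of_injective hinj).trans ?_
      have hs : #s.1 ≤ ℵ₀ := Cardinal.le_aleph0_iff_set_countable.2 s.2
      simp only [Cardinal.mk_pi, Cardinal.prod_const, Cardinal.lift_id, Cardinal.mk_prod, hK]
      rw [Cardinal.mul_eq_self hlam, Cardinal.mul_eq_self hlam]
      exact (Cardinal.power_le_power_left hreg.pos.ne' hs).trans hpow.le
    have hgroup : ∀ s : {s : Set lam.ord.ToType // s.Countable}, #(ClockGroup s.1) ≤ lam := by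
      intro s
      have hinj : Function.Injective fun g : ClockGroup s.1 => g.graph.toList := by
        refine fun g g' h => Finsupp.graph_injective _ _ (Finset.ext fun x => ?_)
        rw [← Finset.mem_toList, show g.graph.toList = g'.graph.toList from h, Finset.mem_toList]
      refine ((Cardinal.mk_le_of_injective hinj).trans (Cardinal.mk_list_le_max _)).trans ?_
      refine max_le hlam ?_
      rw [Cardinal.mk_prod, Cardinal.lift_uzero]
      refine (mul_le_mul' (hclock s) ?_).trans (Cardinal.mul_eq_self hlam).le
      exact (Cardinal.lift_le_aleph0.2 Cardinal.mk_le_aleph0).trans hlam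
    rw [ClockModel, Cardinal.mk_sigma]
    refine (Cardinal.sum_le_mk_mul_iSup _).trans ?_
    refine (mul_le_mul' hsets (ciSup_le' hgroup)).trans ?_
    rw [Cardinal.mul_eq_self hlam]
  · refine hK.symm.le.trans ?_
    refine Cardinal.mk_le_of_injective
      (f := fun x => (⟨⟨{x}, Set.countable_singleton x⟩, 0⟩ : ClockModel lam.ord.ToType)) ?_
    intro x y hxy
    exact Set.singleton_injective (congrArg (fun z : ClockModel _ => z.1.1) hxy)

end Model

/-! ### The game -/

section Translation

variable {K : Type u} [LinearOrder K]

/-- The zero of the group at the empty set. As there is one clock on the empty set, this group has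
two elements. -/
noncomputable def rootZero (K : Type u) [LinearOrder K] : ClockModel K :=
  ⟨⟨∅, Set.countable_empty⟩, 0⟩

/-- The nonzero element of the group at the empty set. -/
noncomputable def rootOne (K : Type u) [LinearOrder K] : ClockModel K :=
  ⟨⟨∅, Set.countable_empty⟩, Finsupp.single default 1⟩

theorem rootZero_ne_rootOne : rootZero K ≠ rootOne K := by
  intro h
  have h1 := eq_of_heq (Sigma.mk.inj h).2
  exact one_ne_zero (Finsupp.single_eq_zero.1 h1.symm)

/-- The graph of the translation, on the groups at countable subsets `s` of `D`, by the restriction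
of `h` to `s`. It is defined at `s` only if this restriction is a clock. -/
def translation (D : Set K) (h : K → K × K × K) : Set (ClockModel K × ClockModel K) :=
  {p | ∃ (s : {s : Set K // s.Countable}) (f : Clock s.1) (g : ClockGroup s.1), s.1 ⊆ D ∧
    (∀ x : s.1, f.val x = h x) ∧ p = (⟨s, g⟩, ⟨s, g + Finsupp.single f 1⟩)}

theorem translation_mono {D D' : Set K} (hD : D ⊆ D') (h : K → K × K × K) :
    translation D h ⊆ translation D' h := by
  rintro _ ⟨s, f, g, hs, hf, rfl⟩
  exact ⟨s, f, g, hs.trans hD, hf, rfl⟩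

theorem translation_congr {D : Set K} {h h' : K → K × K × K} (H : Set.EqOn h h' D) :
    translation D h = translation D h' := by
  have key : ∀ {h h' : K → K × K × K}, Set.EqOn h h' D → translation D h ⊆ translation D h' := by
    rintro h h' H _ ⟨s, f, g, hs, hf, rfl⟩
    exact ⟨s, f, g, hs, fun x => (hf x).trans (H (hs x.2)), rfl⟩
  exact (key H).antisymm (key H.symm)

theorem root_mem_translation (D : Set K) (h : K → K × K × K) :
    (rootZero K, rootOne K) ∈ translation D h :=
  ⟨⟨∅, Set.countable_empty⟩, default, 0, Set.empty_subset _, fun x => x.2.elim,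
    by rw [zero_add]; rfl⟩

theorem translation_fst_eq_iff {D : Set K} {h : K → K × K × K} :
    ∀ p ∈ translation D h, ∀ q ∈ translation D h, (p.1 = q.1 ↔ p.2 = q.2) := by
  rintro _ ⟨s, f, g, -, hf, rfl⟩ _ ⟨s', f', g', -, hf', rfl⟩
  by_cases hs : s = s'
  · subst hs
    obtain rfl : f = f' := Clock.ext (funext fun x => (hf x).trans (hf' x).symm)
    constructor
    · rintro ⟨⟩
      rfl
    · intro H
      rw [add_right_cancel (eq_of_heq (Sigma.mk.inj H).2)]
  · exact iff_of_false (fun H => hs (congrArg Sigma.fst H)) fun H => hs (congrArg Sigma.fst H)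

theorem translation_rel_iff {D : Set K} {h : K → K × K × K} (r : ClockSymbol K) :
    ∀ p ∈ translation D h, ∀ q ∈ translation D h,
      (ClockModel.Rel r p.1 q.1 ↔ ClockModel.Rel r p.2 q.2) := by
  rintro _ ⟨s, f, g, -, hf, rfl⟩ _ ⟨s', f', g', -, hf', rfl⟩
  by_cases hs : s = r.big ∧ s' = r.small
  · obtain ⟨rfl, rfl⟩ := hs
    have hff : f.restrict r.subset = f' :=
      Clock.ext (funext fun x => (hf (Set.inclusion r.subset x)).trans (hf' x).symm)
    rw [ClockModel.rel_mk_iff, ClockModel.rel_mk_iff, map_add, proj_single, hff, add_right_comm,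
      add_left_inj]
  · refine iff_of_false ?_ ?_ <;>
    · rintro ⟨a, b, ha, hb, -⟩
      exact hs ⟨congrArg Sigma.fst ha, congrArg Sigma.fst hb⟩

theorem exists_mem_translation {D : Set K} {h : K → K × K × K}
    (hD : ∀ x ∈ D, ∀ y ∈ D, (h x).1 = (h y).1 ∧ (h x).2.1 < (h x).1 ∧ x < (h x).2.2 ∧
      ((h x).2.1 = (h y).2.1 → (h x).2.2 = (h y).2.2)) {x : ClockModel K} (hx : x.1.1 ⊆ D) :
    x ∈ Prod.fst '' translation D h ∧ x ∈ Prod.snd '' translation D h := by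
  obtain ⟨s, g⟩ := x
  let f : Clock s.1 := ⟨fun x => h x, fun x y => hD x (hx x.2) y (hx y.2)⟩
  refine ⟨⟨_, ⟨s, f, g, hx, fun _ => rfl, rfl⟩, rfl⟩,
    ⟨_, ⟨s, f, g - Finsupp.single f 1, hx, fun _ => rfl, rfl⟩, ?_⟩⟩
  rw [sub_add_cancel]

end Translation

section Play

variable {K : Type u} (b : Ordinal.{u} → K)

/-- The moments before one of the deadlines `b γ` with `γ ≤ β`. -/
def reached [LinearOrder K] (β : Ordinal.{u}) : Set K :=
  {x | ∃ γ ≤ β, x < b γ}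

/-- The first stage whose deadline is after `x`. -/
noncomputable def firstStage [LinearOrder K] (x : K) : Ordinal.{u} :=
  sInf {γ | x < b γ}

/-- The triple of bound, stage and deadline at `x`, when stages are coded by `e`, the bound is
`e α`, and the stage `γ` has the deadline `b γ`. -/
noncomputable def stageClock [LinearOrder K] (e : Ordinal.{u} → K) (α : Ordinal.{u}) (x : K) :
    K × K × K :=
  (e α, e (firstStage b x), b (firstStage b x))

variable [LinearOrder K] {b}

theorem firstStage_le_of_lt {γ : Ordinal.{u}} {x : K} (hx : x < b γ) : firstStage b x ≤ γ := by
  have hmem : γ ∈ {γ | x < b γ} := hx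
  exact csInf_le' hmem

theorem firstStage_le {β : Ordinal.{u}} {x : K} (hx : x ∈ reached b β) : firstStage b x ≤ β := by
  obtain ⟨γ, hγ, hx⟩ := hx
  exact (firstStage_le_of_lt hx).trans hγ

theorem lt_firstStage {β : Ordinal.{u}} {x : K} (hx : x ∈ reached b β) :
    x < b (firstStage b x) := by
  obtain ⟨γ, -, hx⟩ := hx
  have hmem : firstStage b x ∈ {γ | x < b γ} := csInf_mem ⟨γ, hx⟩
  exact hmem

theorem reached_congr {b' : Ordinal.{u} → K} {β : Ordinal.{u}} (hb : ∀ γ ≤ β, b γ = b' γ) :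
    reached b β = reached b' β := by
  ext x
  exact exists_congr fun γ => and_congr_right fun hγ => by rw [hb γ hγ]

theorem firstStage_congr {b' : Ordinal.{u} → K} {β : Ordinal.{u}} (hb : ∀ γ ≤ β, b γ = b' γ)
    {x : K} (hx : x ∈ reached b β) : firstStage b x = firstStage b' x := by
  have hx' : x ∈ reached b' β := reached_congr hb ▸ hx
  apply le_antisymm
  · refine firstStage_le_of_lt ?_
    rw [hb _ (firstStage_le hx')]
    exact lt_firstStage hx'
  · refine firstStage_le_of_lt ?_
    rw [← hb _ (firstStage_le hx)]
    exact lt_firstStage hx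

theorem stageClock_congr {b' : Ordinal.{u} → K} {β : Ordinal.{u}} (hb : ∀ γ ≤ β, b γ = b' γ)
    (e : Ordinal.{u} → K) (α : Ordinal.{u}) :
    Set.EqOn (stageClock b e α) (stageClock b' e α) (reached b β) := by
  intro x hx
  rw [stageClock, stageClock, ← firstStage_congr hb hx, hb _ (firstStage_le hx)]

theorem stageClock_isClock {e : Ordinal.{u} → K} {α β : Ordinal.{u}} (hβ : β < α)
    (he : StrictMonoOn e (Set.Iic α)) {x : K} (hx : x ∈ reached b β) {y : K}
    (hy : y ∈ reached b β) :
    (stageClock b e α x).1 = (stageClock b e α y).1 ∧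
      (stageClock b e α x).2.1 < (stageClock b e α x).1 ∧ x < (stageClock b e α x).2.2 ∧
      ((stageClock b e α x).2.1 = (stageClock b e α y).2.1 →
        (stageClock b e α x).2.2 = (stageClock b e α y).2.2) := by
  have hlt : ∀ {z}, z ∈ reached b β → firstStage b z < α := fun hz =>
    (firstStage_le hz).trans_lt hβ
  refine ⟨rfl, he (hlt hx).le Set.self_mem_Iic (hlt hx), lt_firstStage hx, fun H => ?_⟩
  exact congrArg b (he.injOn (hlt hx).le (hlt hy).le H)

end Play

theorem exists_forall_subset_Iio {lam : Cardinal.{u}} (hreg : lam.IsRegular) (hunc : ℵ₀ < lam)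
    {A₁ A₂ : Set (ClockModel lam.ord.ToType)} (hA : #A₁ + #A₂ < lam) :
    ∃ b, ∀ x ∈ A₁ ∪ A₂, x.1.1 ⊆ Set.Iio b := by
  have hU : #(A₁ ∪ A₂ : Set _) < lam := (Cardinal.mk_union_le _ _).trans_lt hA
  have h1 : #(⋃ x ∈ A₁ ∪ A₂, x.1.1 : Set lam.ord.ToType) < lam := by
    rw [Cardinal.card_biUnion_lt_iff_forall_of_isRegular hreg hU]
    exact fun x _ => (Cardinal.le_aleph0_iff_set_countable.2 x.1.2).trans_lt hunc
  obtain ⟨b, hb⟩ := exists_forall_lt_of_mk_lt hreg h1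
  exact ⟨b, fun x hx y hy => hb y (Set.mem_biUnion hx hy)⟩

/-- The strategy of ISO: in a game of length `α`, the deadline of stage `β` is a bound for the
moments that occur in the challenge of AIS at that stage, and the answer is the translation by
the clock that these deadlines define. -/
theorem efEquiv_clockModel {lam : Cardinal.{u}} (hreg : lam.IsRegular) (hunc : ℵ₀ < lam)
    {μ : Cardinal.{u}} (hμ : 1 + μ ≤ lam) {α : Ordinal.{u}} (hα : α < lam.ord) :
    EFEquiv ((binaryLanguage (ClockSymbol lam.ord.ToType))[[PUnit.{1}]])
      (Pointed (ClockModel lam.ord.ToType) (rootZero _))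
      (Pointed (ClockModel lam.ord.ToType) (rootOne _)) α μ := by
  let c₀ : ClockModel lam.ord.ToType := rootZero _
  let c₁ : ClockModel lam.ord.ToType := rootOne _
  have hbd : ∀ C : Challenge (Pointed _ c₀) (Pointed _ c₁) μ, ∃ b : lam.ord.ToType,
      (∀ x : ClockModel lam.ord.ToType, x ∈ C.1.1 → x.1.1 ⊆ Set.Iio b) ∧
      (∀ x : ClockModel lam.ord.ToType, x ∈ C.1.2 → x.1.1 ⊆ Set.Iio b) := by
    intro C
    obtain ⟨b, hb⟩ := exists_forall_subset_Iio hreg hunc (C.2.trans_le hμ)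
    exact ⟨b, fun x hx => hb x (Or.inl hx), fun x hx => hb x (Or.inr hx)⟩
  choose bd hbd₁ hbd₂ using hbd
  obtain ⟨e, he⟩ : ∃ e : Ordinal.{u} → lam.ord.ToType, StrictMonoOn e (Set.Iic α) := by
    refine ⟨fun o => if h : o < lam.ord then Ordinal.ToType.mk ⟨o, h⟩ else
      Ordinal.ToType.mk ⟨α, hα⟩, fun x hx y hy hxy => ?_⟩
    have hx' : x < lam.ord := lt_of_le_of_lt hx hα
    have hy' : y < lam.ord := lt_of_le_of_lt hy hα
    simp only [hx', hy', dif_pos]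
    exact Ordinal.ToType.mk.lt_iff_lt.2 hxy
  let ans : (Ordinal.{u} → Challenge (Pointed _ c₀) (Pointed _ c₁) μ) → Ordinal.{u} →
      Set (ClockModel lam.ord.ToType × ClockModel lam.ord.ToType) := fun A β =>
    translation (reached (bd ∘ A) β) (stageClock (bd ∘ A) e α)
  refine ⟨fun β A => ans (fun γ => A ⟨min γ β, Set.mem_Iic.2 (min_le_right _ _)⟩) β, fun A f hf => ?_⟩
  -- Later challenges do not affect the answer.
  have hsucc : ∀ β < α, f (β + 1) = ans A β := by
    intro β hβ
    rw [hf.succ β hβ]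
    have hb : ∀ γ ≤ β, (bd ∘ fun γ => A (min γ β)) γ = (bd ∘ A) γ := fun γ hγ => by
      simp [min_eq_left hγ]
    change translation _ _ = translation _ _
    rw [translation_congr (stageClock_congr hb e α), reached_congr hb]
  have hans : ∀ β γ, β ≤ γ → ans A β ⊆ ans A γ := fun β γ h =>
    by
    refine translation_mono ?_ _
    rintro x ⟨δ, hδ, hx⟩
    exact ⟨δ, hδ.trans h, hx⟩
  have hsub : ∀ β ≤ α, ∀ p ∈ f β, ∃ γ < β, p ∈ ans A γ := by
    intro β
    induction β using Ordinal.limitRecOn with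
    | zero => intro _ p hp; rw [hf.zero] at hp; exact hp.elim
    | add_one β _ =>
      intro hβ p hp
      rw [hsucc β ((Order.lt_add_one_iff.2 le_rfl).trans_le hβ)] at hp
      exact ⟨β, Order.lt_add_one_iff.2 le_rfl, hp⟩
    | limit β hlim ih =>
      intro hβ p hp
      rw [hf.limit β hβ hlim] at hp
      simp only [Set.mem_iUnion] at hp
      obtain ⟨γ, hγ, hp⟩ := hp
      obtain ⟨δ, hδ, hp⟩ := ih γ hγ (hγ.le.trans hβ) p hp
      exact ⟨δ, hδ.trans hγ, hp⟩
  have hcover : ∀ β < α, ∀ x : ClockModel lam.ord.ToType, x.1.1 ⊆ Set.Iio (bd (A β)) →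
      x ∈ Prod.fst '' ans A β ∧ x ∈ Prod.snd '' ans A β := fun β hβ x hx =>
    exists_mem_translation (fun _ hy _ hz => stageClock_isClock hβ he hy hz)
      fun y hy => ⟨β, le_rfl, hx hy⟩
  refine ⟨fun β hβ => ?_, fun β hβ p hp => ?_, fun β hβ x hx => ?_, fun β hβ x hx => ?_⟩
  · refine isPartialIso_of_subset (rel := ClockModel.Rel) rfl
      (root_mem_translation Set.univ (stageClock (bd ∘ A) e α)) translation_fst_eq_iff
      translation_rel_iff fun p hp => ?_
    obtain ⟨γ, -, hp⟩ := hsub β hβ p hp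
    exact translation_mono (Set.subset_univ _) _ hp
  · obtain ⟨γ, hγ, hp⟩ := hsub β hβ.le p hp
    rw [hsucc β hβ]
    exact hans γ β hγ.le hp
  · rw [hsucc β hβ]
    exact (hcover β hβ x (hbd₁ (A β) x hx)).1
  · rw [hsucc β hβ]
    exact (hcover β hβ x (hbd₂ (A β) x hx)).2

end EFGame

theorem mainTheorem1 (lam : Cardinal.{u}) (hreg : lam.IsRegular) (hpow : lam ^ ℵ₀ = lam) :
    ∃ (L : FirstOrder.Language.{u, u}) (M : Type u) (_ : L.Structure M),
      #M = lam ∧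
      (∀ f : M ≃[L] M, f = FirstOrder.Language.Equiv.refl L M) ∧
      (∀ α : Ordinal.{u}, α < lam.ord → ∃ c₁ c₂ : M, c₁ ≠ c₂ ∧
        IsEmpty (EFGame.Pointed M c₁ ≃[L[[PUnit.{1}]]] EFGame.Pointed M c₂) ∧
        EFGame.EFEquiv (L[[PUnit.{1}]]) (EFGame.Pointed M c₁) (EFGame.Pointed M c₂) α 1 ∧
        EFGame.EFEquiv (L[[PUnit.{1}]]) (EFGame.Pointed M c₁) (EFGame.Pointed M c₂) α lam) ∧
      (∃ c₁ c₂ : M, c₁ ≠ c₂ ∧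
        IsEmpty (EFGame.Pointed M c₁ ≃[L[[PUnit.{1}]]] EFGame.Pointed M c₂) ∧
        ∀ α : Ordinal.{u}, α < lam.ord →
          EFGame.EFEquiv (L[[PUnit.{1}]]) (EFGame.Pointed M c₁) (EFGame.Pointed M c₂) α lam) := by
  have hunc : ℵ₀ < lam := by
    refine lt_of_le_of_ne hreg.aleph0_le ?_
    rintro rfl
    rw [Cardinal.power_self_eq le_rfl] at hpow
    exact (Cardinal.cantor ℵ₀).ne' hpow
  have hone : 1 + (1 : Cardinal.{u}) ≤ lam :=
    ((Cardinal.add_lt_aleph0 Cardinal.one_lt_aleph0 Cardinal.one_lt_aleph0).trans hunc).le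
  have hlam : 1 + lam ≤ lam := (Cardinal.add_eq_right hunc.le
    (Cardinal.one_lt_aleph0.trans hunc).le).le
  have hrigid := EFGame.ClockModel.equiv_eq_refl (EFGame.isEmpty_clock_univ hreg)
  have hne := EFGame.rootZero_ne_rootOne (K := lam.ord.ToType)
  have hiso := EFGame.isEmpty_pointed_equiv hrigid hne
  exact ⟨_, EFGame.ClockModel lam.ord.ToType, inferInstance, EFGame.mk_clockModel hreg hpow,
    hrigid, fun α hα => ⟨_, _, hne, hiso, EFGame.efEquiv_clockModel hreg hunc hone hα,
      EFGame.efEquiv_clockModel hreg hunc hlam hα⟩,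
    _, _, hne, hiso, fun α hα => EFGame.efEquiv_clockModel hreg hunc hlam hα⟩
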